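/- Let $N\ge 1$ and let $\Omega\subset\mathbb R^N$ be a bounded domain (open, connected, nonempty) with the uniform exterior ball property: there is $\theta>0$ such that for every $y\in\partial\Omega$ there is $z_y\in\mathbb R^N\setminus\Omega$ with $\overline{B_\theta(z_y)}\cap\overline\Omega=\{y\}$. Let $\overline f,\overline g:\mathbb R^N\setminus\Omega\to\mathbb R$ be Lipschitz functions. For $\varepsilon>0$, a solution of the dynamic programming principle (DPP) with step $\varepsilon$ is a pair $(u^\varepsilon,v^\varepsilon)$ of functions $\mathbb R^N\to\mathbb R$, bounded on $\Omega$, with $v^\varepsilon$ integrable on $B_\varepsilon(x)$ for every $x\in\Omega$, such that $$ \begin{cases} u^{\varepsilon}(x)=\varepsilon^{2}v^{\varepsilon}(x)+(1-\varepsilon^{2})\Big\{\tfrac12\sup\limits_{y\in B_\varepsilon(x)}u^{\varepsilon}(y)+\tfrac12\inf\limits_{y\in B_\varepsilon(x)}u^{\varepsilon}(y)\Big\}, & x\in\Omega,\\[6pt] v^{\varepsilon}(x)=\varepsilon^{2}u^{\varepsilon}(x)+(1-\varepsilon^{2})\dfrac{1}{|B_\varepsilon(x)|}\displaystyle\int_{B_\varepsilon(x)}v^{\varepsilon}(y)\,dy,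 & x\in\Omega,\\[6pt] u^{\varepsilon}(x)=\overline f(x),\qquad v^{\varepsilon}(x)=\overline g(x), & x\in\mathbb R^N\setminus\Omega, \end{cases} $$ where $B_\varepsilon(x)$ is the open Euclidean ball. Let $(\varepsilon_j)_{j\in\mathbb N}$ be a sequence of positive numbers with $\varepsilon_j\to0$ and, for each $j$, let $(u^{\varepsilon_j},v^{\varepsilon_j})$ be a solution of the DPP with step $\varepsilon_j$ (the data $\Omega,\overline f,\overline g$ being fixed). Then there exist a subsequence $(\varepsilon_{j_k})_k$ and functions $u,v:\overline\Omega\to\mathbb R$, continuous on $\overline\Omega$, such that $$u^{\varepsilon_{j_k}}\to u\qquad\text{and}\qquad v^{\varepsilon_{j_k}}\to v\qquad\text{as }k\to\infty,$$ uniformly in $\overline\Omega$ (the same subsequence for both components). -/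

import Mathlib

open Filter Topology MeasureTheory Metric
open scoped NNReal

/-- The uniform exterior ball property: there is a radius `θ > 0` such that every boundary point
`y` of `Ω` is the only point of `closure Ω` in some closed ball of radius `θ` centred outside
`Ω`. -/
def UniformExteriorBall {N : ℕ} (Ω : Set (EuclideanSpace ℝ (Fin N))) : Prop :=
  ∃ θ : ℝ, 0 < θ ∧ ∀ y ∈ frontier Ω, ∃ z ∈ Ωᶜ, closedBall z θ ∩ closure Ω = {y}

/-- `(u, v)` is a solution of the dynamic programming principle with step size `ε`, domain `Ω` and
exterior data `f` (first board) and `g` (second board); only the values of `f` and `g` on `Ωᶜ`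
matter. The balls are open, and the mean value is with respect to Lebesgue measure.

The first two fields make the suprema, infima and mean values meaningful: solutions are bounded
(on `Ω`; on `Ωᶜ` they are the prescribed data) and the second component is integrable on the
balls over which it is averaged. The bound may depend on the solution, hence on `ε`. -/
structure IsDPPSolution {N : ℕ} (Ω : Set (EuclideanSpace ℝ (Fin N)))
    (f g : EuclideanSpace ℝ (Fin N) → ℝ) (ε : ℝ)
    (u v : EuclideanSpace ℝ (Fin N) → ℝ) : Prop where
  bounded : ∃ C : ℝ, ∀ x ∈ Ω, |u x| ≤ C ∧ |v x| ≤ C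
  integrableOn_ball : ∀ x ∈ Ω, IntegrableOn v (ball x ε)
  eq_first : ∀ x ∈ Ω,
    u x = ε ^ 2 * v x
      + (1 - ε ^ 2) * ((1 / 2) * sSup (u '' ball x ε) + (1 / 2) * sInf (u '' ball x ε))
  eq_second : ∀ x ∈ Ω,
    v x = ε ^ 2 * u x + (1 - ε ^ 2) * ⨍ y in ball x ε, v y
  exterior_first : ∀ x ∈ Ωᶜ, u x = f x
  exterior_second : ∀ x ∈ Ωᶜ, v x = g x

/-!
Both averaging operators, the midrange and the mean value over a ball, are monotone and commute
with the addition of constants. Everything is deduced from these properties and from the action of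
the operators on Gaussians, by comparison; no game or random walk is used.

*Comparison for the system* (`IsDPPOn.comparison`). Let `K` be the supremum over `D` of the
differences of the components of two solutions, and suppose that the differences are at most
`η < K` off `D`. The second equation is linear and loses the fraction `ε ^ 2` of the mean value at
each step. A Gaussian `ω` with a far centre satisfies `ω ≤ (1 - ε ^ 2) * (mean of ω)` for small
`ε`, so `K - (v₁ - v₂)` is bounded below by a positive multiple of `ω`. The first equation
then keeps `u₁ - u₂` away from `K` too, a contradiction. Since constants solve the system, this
bounds all solutions with small `ε` by the exterior data near `Ω` (`eventually_abs_le`).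

*Boundary estimate* (`eventually_abs_sub_le_near_boundary`). Given the uniform bound, the coupling
is an error `O(ε ^ 2)` in each equation, and each component can be compared separately with a
barrier `a - b * exp (-α * |x - p| ^ 2)`. For `α` large this is a strict supersolution for both
operators (`ballMid_le_of_le_sub_gaussian`, `gaussian_le_setAverage`), with a gain of order
`b * ε ^ 2` that absorbs the error. The centre `p` comes from the exterior ball.

*Equicontinuity* (`eventually_abs_sub_le`). The equations are invariant under translation. On
`Ω ∩ (Ω - a)` a solution is compared with its translate by `a`; off this set both values are taken
near the boundary, where the boundary estimate applies. So the oscillation at scale `δ` is small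
once `ε` is small, and a diagonal argument as for the Arzelà–Ascoli theorem
(`exists_subseq_tendstoUniformlyOn`) gives the subsequence.
-/

/-! ### Mean values and midranges over balls -/

/-- The averaging operator of the first equation: the mean of the supremum and the infimum of `u`
over the open ball of radius `ε` about `x`. -/
noncomputable def ballMid {X : Type*} [PseudoMetricSpace X] (ε : ℝ) (u : X → ℝ) (x : X) : ℝ :=
  (1 / 2) * sSup (u '' ball x ε) + (1 / 2) * sInf (u '' ball x ε)

theorem ballMid_le_add {X : Type*} [PseudoMetricSpace X] {ε : ℝ} (hε : 0 < ε) {u₁ u₂ : X → ℝ}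
    {x : X} {C m : ℝ} (h₁ : ∀ y ∈ ball x ε, |u₁ y| ≤ C) (h₂ : ∀ y ∈ ball x ε, |u₂ y| ≤ C)
    (h : ∀ y ∈ ball x ε, u₁ y ≤ u₂ y + m) : ballMid ε u₁ x ≤ ballMid ε u₂ x + m := by
  have hx : x ∈ ball x ε := mem_ball_self hε
  have ne : ∀ u : X → ℝ, (u '' ball x ε).Nonempty := fun u => ⟨u x, x, hx, rfl⟩
  have hs : sSup (u₁ '' ball x ε) ≤ sSup (u₂ '' ball x ε) + m := by
    apply csSup_le (ne _)
    rintro _ ⟨y, hy, rfl⟩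
    have : u₂ y ≤ sSup (u₂ '' ball x ε) :=
      le_csSup ⟨C, by rintro _ ⟨y, hy, rfl⟩; exact (abs_le.1 (h₂ y hy)).2⟩ ⟨y, hy, rfl⟩
    linarith [h y hy]
  have hi : sInf (u₁ '' ball x ε) - m ≤ sInf (u₂ '' ball x ε) := by
    apply le_csInf (ne _)
    rintro _ ⟨y, hy, rfl⟩
    have : sInf (u₁ '' ball x ε) ≤ u₁ y :=
      csInf_le ⟨-C, by rintro _ ⟨y, hy, rfl⟩; exact (abs_le.1 (h₁ y hy)).1⟩ ⟨y, hy, rfl⟩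
    linarith [h y hy]
  unfold ballMid
  linarith

theorem ballMid_const {X : Type*} [PseudoMetricSpace X] {ε : ℝ} (hε : 0 < ε) (B : ℝ) (x : X) :
    ballMid ε (fun _ => B) x = B := by
  have hx : (ball x ε).Nonempty := ⟨x, mem_ball_self hε⟩
  simp only [ballMid, hx.image_const, csSup_singleton, csInf_singleton]
  ring

theorem ballMid_neg {X : Type*} [PseudoMetricSpace X] (ε : ℝ) (u : X → ℝ) (x : X) :
    ballMid ε (fun y => -u y) x = -ballMid ε u x := by
  have : (fun y => -u y) '' ball x ε = -(u '' ball x ε) := by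
    rw [← Set.image_neg_eq_neg, Set.image_image]
  have h2 : sInf (-(u '' ball x ε)) = -sSup (u '' ball x ε) := by
    rw [Real.sInf_def, neg_neg]
  have h3 : sSup (-(u '' ball x ε)) = -sInf (u '' ball x ε) := by
    rw [Real.sInf_def, neg_neg]
  simp only [ballMid, this, h2, h3]
  ring

section Average

variable {N : ℕ}

theorem volume_ball_toReal_pos {ε : ℝ} (hε : 0 < ε) (x : EuclideanSpace ℝ (Fin N)) :
    0 < volume.real (ball x ε) :=
  ENNReal.toReal_pos (measure_ball_pos _ _ hε).ne' measure_ball_lt_top.ne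

theorem setAverage_ball_le_add {ε : ℝ} (hε : 0 < ε) {v₁ v₂ : EuclideanSpace ℝ (Fin N) → ℝ}
    {x : EuclideanSpace ℝ (Fin N)} {m : ℝ} (h₁ : IntegrableOn v₁ (ball x ε))
    (h₂ : IntegrableOn v₂ (ball x ε)) (h : ∀ y ∈ ball x ε, v₁ y ≤ v₂ y + m) :
    ⨍ y in ball x ε, v₁ y ≤ (⨍ y in ball x ε, v₂ y) + m := by
  have hp := volume_ball_toReal_pos hε x
  have hc : IntegrableOn (fun _ : EuclideanSpace ℝ (Fin N) => m) (ball x ε) :=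
    integrableOn_const measure_ball_lt_top.ne
  have hI : ∫ y in ball x ε, v₁ y ≤ (∫ y in ball x ε, v₂ y) + volume.real (ball x ε) * m := by
    have := setIntegral_mono_on h₁ (h₂.add hc) measurableSet_ball h
    simp only [Pi.add_apply] at this
    rwa [integral_add h₂ hc, setIntegral_const, smul_eq_mul] at this
  rw [setAverage_eq, setAverage_eq, smul_eq_mul, smul_eq_mul]
  calc _ ≤ (volume.real (ball x ε))⁻¹ * ((∫ y in ball x ε, v₂ y) + volume.real (ball x ε) * m) := by
        gcongr
    _ = _ := by field_simp

theorem setAverage_ball_const {ε : ℝ} (hε : 0 < ε) (B : ℝ) (x : EuclideanSpace ℝ (Fin N)) :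
    ⨍ _ in ball x ε, B = B :=
  setAverage_const (measure_ball_pos _ _ hε).ne' measure_ball_lt_top.ne B

theorem setAverage_ball_add_right (ε : ℝ) (v : EuclideanSpace ℝ (Fin N) → ℝ)
    (x h : EuclideanSpace ℝ (Fin N)) :
    ⨍ y in ball x ε, v (y + h) = ⨍ y in ball (x + h) ε, v y := by
  have hpre : (fun y => y + h) ⁻¹' ball (x + h) ε = ball x ε := by
    ext y; simp
  have := (measurePreserving_add_right volume h).setIntegral_preimage_emb
    (MeasurableEquiv.addRight h).measurableEmbedding v (ball (x + h) ε)
  rw [hpre] at this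
  rw [setAverage_eq, setAverage_eq, this]
  congr 2
  simp only [Measure.real, Measure.addHaar_ball_center]

theorem integrableOn_ball_add_right {ε : ℝ} {v : EuclideanSpace ℝ (Fin N) → ℝ}
    {x h : EuclideanSpace ℝ (Fin N)} (hv : IntegrableOn v (ball (x + h) ε)) :
    IntegrableOn (fun y => v (y + h)) (ball x ε) := by
  have hpre : (fun y => y + h) ⁻¹' ball (x + h) ε = ball x ε := by
    ext y; simp
  have := ((measurePreserving_add_right volume h).integrableOn_comp_preimage
    (MeasurableEquiv.addRight h).measurableEmbedding (f := v) (s := ball (x + h) ε)).2 hv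
  rwa [hpre] at this

theorem integrableOn_ball_of_continuous {F : EuclideanSpace ℝ (Fin N) → ℝ} (hF : Continuous F)
    (x : EuclideanSpace ℝ (Fin N)) (ε : ℝ) : IntegrableOn F (ball x ε) :=
  (hF.continuousOn.integrableOn_compact (isCompact_closedBall x ε)).mono_set ball_subset_closedBall

theorem setAverage_ball_symm {F : EuclideanSpace ℝ (Fin N) → ℝ} (hF : Continuous F)
    (x : EuclideanSpace ℝ (Fin N)) (ε : ℝ) :
    ⨍ y in ball x ε, F y = ⨍ h in ball (0 : EuclideanSpace ℝ (Fin N)) ε,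
      (F (x + h) + F (x - h)) / 2 := by
  have h1 : ⨍ y in ball x ε, F y = ⨍ h in ball (0 : EuclideanSpace ℝ (Fin N)) ε, F (x + h) := by
    have := setAverage_ball_add_right ε F 0 x
    rw [zero_add] at this
    rw [← this]
    simp only [add_comm]
  have h2 : ∫ h in ball (0 : EuclideanSpace ℝ (Fin N)) ε, F (x - h)
      = ∫ h in ball (0 : EuclideanSpace ℝ (Fin N)) ε, F (x + h) := by
    have hpre : (fun y => -y) ⁻¹' ball (0 : EuclideanSpace ℝ (Fin N)) ε = ball 0 ε := by
      ext y; simp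
    have := (Measure.measurePreserving_neg
      (volume : Measure (EuclideanSpace ℝ (Fin N)))).setIntegral_preimage_emb
      (MeasurableEquiv.neg _).measurableEmbedding (fun h => F (x + h)) (ball 0 ε)
    rw [hpre] at this
    simpa only [← sub_eq_add_neg] using this
  rw [h1, setAverage_eq, setAverage_eq, integral_div, integral_add, h2]
  · congr 1; ring
  · exact integrableOn_ball_of_continuous (by fun_prop) _ _
  · exact integrableOn_ball_of_continuous (by fun_prop) _ _

/-- A lower bound for the second moment of a ball in the direction `ξ`: the integrand is at least
`(ε / 4) ^ 2 * ‖ξ‖ ^ 2` on a ball of a quarter of the radius. -/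
theorem le_setAverage_inner_sq {ε : ℝ} (hε : 0 < ε) (ξ : EuclideanSpace ℝ (Fin N)) :
    (1 / 4) ^ N / 16 * ε ^ 2 * ‖ξ‖ ^ 2
      ≤ ⨍ h in ball (0 : EuclideanSpace ℝ (Fin N)) ε, inner ℝ ξ h ^ 2 := by
  rcases eq_or_ne ξ 0 with rfl | hξ
  · simp
  have hn : 0 < ‖ξ‖ := norm_pos_iff.2 hξ
  set p : EuclideanSpace ℝ (Fin N) := (ε / 2 / ‖ξ‖) • ξ with hp
  have hpn : ‖p‖ = ε / 2 := by
    rw [hp, norm_smul, Real.norm_of_nonneg (by positivity)]; field_simp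
  have hsub : ball p (ε / 4) ⊆ ball 0 ε := by
    intro h hh
    rw [mem_ball_zero_iff]
    rw [mem_ball_iff_norm] at hh
    have := norm_le_norm_add_norm_sub p h
    rw [norm_sub_rev] at this
    linarith
  have hlow : ∀ h ∈ ball p (ε / 4), ε ^ 2 / 16 * ‖ξ‖ ^ 2 ≤ inner ℝ ξ h ^ 2 := by
    intro h hh
    rw [mem_ball_iff_norm] at hh
    have h1 : inner ℝ ξ h = inner ℝ ξ p + inner ℝ ξ (h - p) := by
      rw [← inner_add_right]; simp
    have h2 : inner ℝ ξ p = ε / 2 * ‖ξ‖ := by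
      rw [hp, inner_smul_right, real_inner_self_eq_norm_sq]; field_simp
    have h3 := (abs_le.1 (abs_real_inner_le_norm ξ (h - p))).1
    have h4 : ‖ξ‖ * ‖h - p‖ ≤ ‖ξ‖ * (ε / 4) := by gcongr
    have h5 : ε / 4 * ‖ξ‖ ≤ inner ℝ ξ h := by rw [h1, h2]; linarith
    calc ε ^ 2 / 16 * ‖ξ‖ ^ 2 = (ε / 4 * ‖ξ‖) ^ 2 := by ring
      _ ≤ _ := by gcongr
  have hint : IntegrableOn (fun h => inner ℝ ξ h ^ 2) (ball (0 : EuclideanSpace ℝ (Fin N)) ε) :=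
    integrableOn_ball_of_continuous (by fun_prop) _ _
  have hvol : volume.real (ball p (ε / 4))
      = (1 / 4) ^ N * volume.real (ball (0 : EuclideanSpace ℝ (Fin N)) ε) := by
    rw [Measure.real, Measure.real, Measure.addHaar_ball_of_pos _ _ (by positivity),
      Measure.addHaar_ball_of_pos _ (0 : EuclideanSpace ℝ (Fin N)) hε, ENNReal.toReal_mul,
      ENNReal.toReal_mul,
      ENNReal.toReal_ofReal (by positivity), ENNReal.toReal_ofReal (by positivity)]
    simp only [finrank_euclideanSpace, Fintype.card_fin]
    rw [div_eq_mul_one_div, mul_pow]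
    ring
  have hI : volume.real (ball p (ε / 4)) * (ε ^ 2 / 16 * ‖ξ‖ ^ 2)
      ≤ ∫ h in ball (0 : EuclideanSpace ℝ (Fin N)) ε, inner ℝ ξ h ^ 2 := by
    calc _ = ∫ _ in ball p (ε / 4), ε ^ 2 / 16 * ‖ξ‖ ^ 2 := by
          rw [setIntegral_const, smul_eq_mul]
      _ ≤ ∫ h in ball p (ε / 4), inner ℝ ξ h ^ 2 :=
          setIntegral_mono_on (integrableOn_const measure_ball_lt_top.ne) (hint.mono_set hsub)
            measurableSet_ball hlow
      _ ≤ _ := setIntegral_mono_set hint (ae_of_all _ fun _ => sq_nonneg _) hsub.eventuallyLE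
  have hP := volume_ball_toReal_pos hε (0 : EuclideanSpace ℝ (Fin N))
  rw [setAverage_eq, smul_eq_mul, inv_mul_eq_div, le_div_iff₀ hP]
  rw [hvol] at hI
  linarith

/-! ### The Gaussian barrier -/

theorem gaussian_factor_le {α ε t s : ℝ} (hα : 0 ≤ α) (hαε : α * ε ^ 2 ≤ 1 / 2) (ht : t ≤ ε ^ 2) :
    1 - α * ε ^ 2 + α ^ 2 * s ^ 2 ≤ Real.exp (-α * t) * Real.cosh (2 * α * s) := by
  have h1 : 1 - α * t ≤ Real.exp (-α * t) := by
    have := Real.add_one_le_exp (-α * t); linarith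
  have h2 : 1 + 2 * α ^ 2 * s ^ 2 ≤ Real.cosh (2 * α * s) := by
    have h : ∀ a : ℝ, 1 + a ^ 2 / 2 ≤ Real.cosh a := by
      intro a
      have e := Real.cosh_two_mul (a / 2)
      have e2 := Real.cosh_sq (a / 2)
      have : (a / 2) ^ 2 ≤ Real.sinh (a / 2) ^ 2 := by
        rw [sq_le_sq, Real.abs_sinh]
        exact Real.self_le_sinh_iff.2 (abs_nonneg _)
      rw [show 2 * (a / 2) = a by ring] at e
      nlinarith
    have := h (2 * α * s)
    linarith [show (2 * α * s) ^ 2 / 2 = 2 * α ^ 2 * s ^ 2 by ring]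
  have h3 : α * t ≤ α * ε ^ 2 := by gcongr
  calc 1 - α * ε ^ 2 + α ^ 2 * s ^ 2
      ≤ (1 - α * t) * (1 + 2 * α ^ 2 * s ^ 2) := by nlinarith [sq_nonneg (α * s)]
    _ ≤ _ := mul_le_mul h1 h2 (by positivity) (Real.exp_pos _).le

theorem exp_add_exp_div_two (α A s t : ℝ) :
    (Real.exp (-α * (A + 2 * s + t)) + Real.exp (-α * (A - 2 * s + t))) / 2
      = Real.exp (-α * A) * (Real.exp (-α * t) * Real.cosh (2 * α * s)) := by
  rw [show -α * (A + 2 * s + t) = -α * A + (-α * t + -(2 * α * s)) by ring,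
    show -α * (A - 2 * s + t) = -α * A + (-α * t + 2 * α * s) by ring, Real.cosh_eq,
    Real.exp_add, Real.exp_add, Real.exp_add, Real.exp_add]
  ring

/-- The Gaussian `y ↦ exp (-α * dist y z ^ 2)`. Away from its centre `z` it is, for large `α`, a
strict subsolution for both averaging operators. -/
noncomputable def gaussian {X : Type*} [PseudoMetricSpace X] (α : ℝ) (z y : X) : ℝ :=
  Real.exp (-α * dist y z ^ 2)

theorem continuous_gaussian {X : Type*} [PseudoMetricSpace X] (α : ℝ) (z : X) :
    Continuous (gaussian α z) := by
  unfold gaussian; fun_prop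

theorem gaussian_pos {X : Type*} [PseudoMetricSpace X] (α : ℝ) (z y : X) : 0 < gaussian α z y :=
  Real.exp_pos _

theorem gaussian_le_one {X : Type*} [PseudoMetricSpace X] {α : ℝ} (hα : 0 ≤ α) (z y : X) :
    gaussian α z y ≤ 1 := by
  refine Real.exp_le_one_iff.2 ?_
  have : 0 ≤ α * dist y z ^ 2 := by positivity
  linarith

theorem gaussian_le_setAverage {α ε r : ℝ} (hε : 0 < ε) (hα : 0 ≤ α) (hαε : α * ε ^ 2 ≤ 1 / 2)
    (hr : 0 ≤ r) (hαr : 2 ≤ α * ((1 / 4) ^ N / 16) * r ^ 2) {x z : EuclideanSpace ℝ (Fin N)}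
    (hx : r ≤ dist x z) :
    (1 + α * ε ^ 2) * gaussian α z x ≤ ⨍ y in ball x ε, gaussian α z y := by
  set c : ℝ := (1 / 4) ^ N / 16
  have hc : 0 < c := by positivity
  have hG := gaussian_pos α z x
  have hcont : Continuous fun h : EuclideanSpace ℝ (Fin N) =>
      gaussian α z x * (1 - α * ε ^ 2 + α ^ 2 * inner ℝ (x - z) h ^ 2) := by fun_prop
  have hsymm := setAverage_ball_symm (continuous_gaussian α z) x ε
  have hpt : ∀ h ∈ ball (0 : EuclideanSpace ℝ (Fin N)) ε,
      gaussian α z x * (1 - α * ε ^ 2 + α ^ 2 * inner ℝ (x - z) h ^ 2)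
        ≤ (gaussian α z (x + h) + gaussian α z (x - h)) / 2 + 0 := by
    intro h hh
    rw [mem_ball_zero_iff] at hh
    have h1 := gaussian_factor_le (s := inner ℝ (x - z) h) hα hαε
      (show ‖h‖ ^ 2 ≤ ε ^ 2 by gcongr)
    have e1 : ‖x + h - z‖ ^ 2 = ‖x - z‖ ^ 2 + 2 * inner ℝ (x - z) h + ‖h‖ ^ 2 := by
      rw [show x + h - z = (x - z) + h by abel, norm_add_sq_real]
    have e2 : ‖x - h - z‖ ^ 2 = ‖x - z‖ ^ 2 - 2 * inner ℝ (x - z) h + ‖h‖ ^ 2 := by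
      rw [show x - h - z = (x - z) - h by abel, norm_sub_sq_real]
    have e3 : (gaussian α z (x + h) + gaussian α z (x - h)) / 2
        = gaussian α z x * (Real.exp (-α * ‖h‖ ^ 2) * Real.cosh (2 * α * inner ℝ (x - z) h)) := by
      simp only [gaussian, dist_eq_norm, e1, e2]
      exact exp_add_exp_div_two _ _ _ _
    rw [e3, add_zero]
    gcongr
  have hle := setAverage_ball_le_add hε (integrableOn_ball_of_continuous hcont 0 ε)
    (integrableOn_ball_of_continuous
      (F := fun h => (gaussian α z (x + h) + gaussian α z (x - h)) / 2)
      (by have := continuous_gaussian α z; fun_prop) 0 ε) hpt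
  rw [hsymm]
  rw [add_zero] at hle
  refine le_trans ?_ hle
  have hP := volume_ball_toReal_pos hε (0 : EuclideanSpace ℝ (Fin N))
  have hI : IntegrableOn (fun h : EuclideanSpace ℝ (Fin N) => inner ℝ (x - z) h ^ 2) (ball 0 ε) :=
    integrableOn_ball_of_continuous (by fun_prop) _ _
  have heq : ⨍ h in ball (0 : EuclideanSpace ℝ (Fin N)) ε,
        gaussian α z x * (1 - α * ε ^ 2 + α ^ 2 * inner ℝ (x - z) h ^ 2)
      = gaussian α z x *
        (1 - α * ε ^ 2 + α ^ 2 * ⨍ h in ball (0 : EuclideanSpace ℝ (Fin N)) ε, inner ℝ (x - z) h ^ 2) :=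
    by
    simp only [setAverage_eq, smul_eq_mul]
    rw [integral_const_mul, integral_add
      (integrableOn_ball_of_continuous (F := fun _ => 1 - α * ε ^ 2) continuous_const 0 ε)
      (hI.const_mul _), setIntegral_const, integral_const_mul, smul_eq_mul]
    field_simp
  rw [heq, mul_comm]
  have hm := le_setAverage_inner_sq hε (x - z)
  rw [← dist_eq_norm] at hm
  have h1 : c * ε ^ 2 * r ^ 2 ≤ c * ε ^ 2 * dist x z ^ 2 := by gcongr
  have h2 : α ^ 2 * (c * ε ^ 2 * r ^ 2)
      ≤ α ^ 2 * ⨍ h in ball (0 : EuclideanSpace ℝ (Fin N)) ε, inner ℝ (x - z) h ^ 2 := by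
    gcongr
    exact h1.trans hm
  have h3 : α * ε ^ 2 * 2 ≤ α * ε ^ 2 * (α * c * r ^ 2) := by gcongr
  refine mul_le_mul_of_nonneg_left ?_ hG.le
  linarith

/-- The midrange counterpart of `gaussian_le_setAverage`. The supremum of the Gaussian over a ball
is approached at the point of the sphere nearest to `z`, the infimum at the farthest one. -/
theorem ballMid_le_of_le_sub_gaussian {α ε r C a b : ℝ} (hε : 0 < ε) (hα : 0 ≤ α)
    (hαε : α * ε ^ 2 ≤ 1 / 2) (hr : 0 < r) (hαr : 2 ≤ α * r ^ 2) (hb : 0 ≤ b)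
    {x z : EuclideanSpace ℝ (Fin N)} (hx : r ≤ dist x z) {w : EuclideanSpace ℝ (Fin N) → ℝ}
    (hw : ∀ y ∈ ball x ε, |w y| ≤ C) (h : ∀ y ∈ ball x ε, w y ≤ a - b * gaussian α z y) :
    ballMid ε w x ≤ a - b * ((1 + α * ε ^ 2) * gaussian α z x) := by
  set d := dist x z with hd
  have hd0 : 0 < d := hr.trans_le hx
  have hs : sSup (w '' ball x ε) ≤ a - b * Real.exp (-α * (d + ε) ^ 2) := by
    refine csSup_le ⟨w x, x, mem_ball_self hε, rfl⟩ ?_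
    rintro _ ⟨y, hy, rfl⟩
    refine (h y hy).trans ?_
    have : dist y z ≤ d + ε := by
      have := dist_triangle y x z
      have := mem_ball.1 hy
      linarith
    have h2 : dist y z ^ 2 ≤ (d + ε) ^ 2 := by gcongr
    have h3 : Real.exp (-α * (d + ε) ^ 2) ≤ gaussian α z y := by
      apply Real.exp_le_exp.2
      nlinarith
    nlinarith
  have hi : sInf (w '' ball x ε) ≤ a - b * Real.exp (-α * (d - ε) ^ 2) := by
    have hcl : closedBall x ε ⊆ {y | sInf (w '' ball x ε) ≤ a - b * gaussian α z y} := by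
      rw [← closure_ball x hε.ne']
      refine closure_minimal ?_ ?_
      · intro y hy
        refine (csInf_le (a := w y) ⟨-C, ?_⟩ (Set.mem_image_of_mem w hy)).trans (h y hy)
        rintro _ ⟨y, hy, rfl⟩
        exact (abs_le.1 (hw y hy)).1
      · have := continuous_gaussian α z
        exact isClosed_le continuous_const (by fun_prop)
    have hmem : x - (ε / d) • (x - z) ∈ closedBall x ε := by
      rw [mem_closedBall, dist_eq_norm, sub_sub_cancel_left, norm_neg, norm_smul, ← dist_eq_norm,
        ← hd, Real.norm_of_nonneg (by positivity)]
      apply le_of_eq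
      field_simp
    have := hcl hmem
    simp only [Set.mem_ofPred_eq, gaussian] at this
    have e : dist (x - (ε / d) • (x - z)) z ^ 2 = (d - ε) ^ 2 := by
      rw [dist_eq_norm, show x - (ε / d) • (x - z) - z = ((1 - ε / d : ℝ)) • (x - z) by module,
        norm_smul (1 - ε / d : ℝ) (x - z), ← dist_eq_norm x z, ← hd, mul_pow, Real.norm_eq_abs,
        sq_abs, ← mul_pow]
      congr 1
      field_simp
    rwa [e] at this
  have hf := gaussian_factor_le (s := d * ε) hα hαε (le_refl (ε ^ 2))
  have e3 : (Real.exp (-α * (d + ε) ^ 2) + Real.exp (-α * (d - ε) ^ 2)) / 2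
      = gaussian α z x * (Real.exp (-α * ε ^ 2) * Real.cosh (2 * α * (d * ε))) := by
    rw [gaussian, ← hd, ← exp_add_exp_div_two]
    ring_nf
  have hG := gaussian_pos α z x
  have h1 : α * ε ^ 2 * 2 ≤ α * ε ^ 2 * (α * d ^ 2) := by
    gcongr
    exact hαr.trans (by gcongr)
  have h4 : (1 + α * ε ^ 2) * gaussian α z x
      ≤ (Real.exp (-α * (d + ε) ^ 2) + Real.exp (-α * (d - ε) ^ 2)) / 2 := by
    rw [e3, mul_comm]
    gcongr
    refine le_trans ?_ hf
    linarith
  have h5 := mul_le_mul_of_nonneg_left h4 hb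
  unfold ballMid
  linarith

end Average

/-! ### Comparison for the system -/

/-- The equations of the dynamic programming principle on a set `D`, with the bounds and the
integrability that give them a meaning, and no condition off `D`. Unlike `IsDPPSolution` this is
stable under translation and under shrinking the set. -/
structure IsDPPOn {N : ℕ} (D : Set (EuclideanSpace ℝ (Fin N))) (ε : ℝ)
    (u v : EuclideanSpace ℝ (Fin N) → ℝ) : Prop where
  bounded : ∃ C : ℝ, ∀ x ∈ D, ∀ y ∈ ball x ε, |u y| ≤ C ∧ |v y| ≤ C
  integrableOn_ball : ∀ x ∈ D, IntegrableOn v (ball x ε)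
  eq_first : ∀ x ∈ D, u x = ε ^ 2 * v x + (1 - ε ^ 2) * ballMid ε u x
  eq_second : ∀ x ∈ D, v x = ε ^ 2 * u x + (1 - ε ^ 2) * ⨍ y in ball x ε, v y

namespace IsDPPOn

variable {N : ℕ} {D : Set (EuclideanSpace ℝ (Fin N))} {ε : ℝ}
  {u v : EuclideanSpace ℝ (Fin N) → ℝ}

theorem mono (h : IsDPPOn D ε u v) {D' : Set (EuclideanSpace ℝ (Fin N))} (hD : D' ⊆ D) :
    IsDPPOn D' ε u v where
  bounded := h.bounded.imp fun _ hC x hx => hC x (hD hx)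
  integrableOn_ball x hx := h.integrableOn_ball x (hD hx)
  eq_first x hx := h.eq_first x (hD hx)
  eq_second x hx := h.eq_second x (hD hx)

theorem const (hε : 0 < ε) (D : Set (EuclideanSpace ℝ (Fin N))) (B : ℝ) :
    IsDPPOn D ε (fun _ => B) (fun _ => B) where
  bounded := ⟨|B|, fun _ _ _ _ => ⟨le_rfl, le_rfl⟩⟩
  integrableOn_ball _ _ := integrableOn_ball_of_continuous continuous_const _ _
  eq_first x _ := by rw [ballMid_const hε]; ring
  eq_second x _ := by rw [setAverage_ball_const hε]; ring

theorem comp_add_right (h : IsDPPOn D ε u v) (a : EuclideanSpace ℝ (Fin N)) :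
    IsDPPOn {x | x + a ∈ D} ε (fun x => u (x + a)) (fun x => v (x + a)) where
  bounded := h.bounded.imp fun _ hC x hx y hy => hC (x + a) hx (y + a) (by simpa using hy)
  integrableOn_ball x hx := integrableOn_ball_add_right (h.integrableOn_ball _ hx)
  eq_first x hx := by
    have hi : (fun y => u (y + a)) '' ball x ε = u '' ball (x + a) ε := by
      rw [← Set.image_image u (fun y => y + a)]
      congr 1
      ext y
      simp
    have := h.eq_first _ hx
    simpa only [ballMid, hi] using this
  eq_second x hx := by
    have := h.eq_second _ hx
    simpa only [setAverage_ball_add_right] using this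

theorem neg (h : IsDPPOn D ε u v) : IsDPPOn D ε (fun x => -u x) (fun x => -v x) where
  bounded := by simpa only [abs_neg] using h.bounded
  integrableOn_ball x hx := (h.integrableOn_ball x hx).neg
  eq_first x hx := by rw [ballMid_neg, h.eq_first x hx]; ring
  eq_second x hx := by
    have : ⨍ y in ball x ε, -v y = -⨍ y in ball x ε, v y := by
      simp only [setAverage_eq, integral_neg, smul_neg]
    rw [this, h.eq_second x hx]; ring

/-- Comparison principle: two solutions that differ by at most `η` off `D` differ by at most `η`
on `D`. The second equation is linear with killing rate `ε ^ 2`, so a strictly positive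
subsolution `ω` of it shows that `v₁ - v₂` stays strictly below the supremum `K` of all the
differences, unless `K ≤ η`; the coupling then pushes `u₁ - u₂` strictly below `K` as well. -/
theorem comparison {u₁ v₁ u₂ v₂ ω : EuclideanSpace ℝ (Fin N) → ℝ} {c η : ℝ}
    (h₁ : IsDPPOn D ε u₁ v₁) (h₂ : IsDPPOn D ε u₂ v₂) (hε : 0 < ε) (hε1 : ε < 1)
    (hωc : Continuous ω) (hω1 : ∀ x, ω x ≤ 1) (hc : 0 < c) (hωD : ∀ x ∈ D, c ≤ ω x)
    (hω : ∀ x ∈ D, ω x ≤ (1 - ε ^ 2) * ⨍ y in ball x ε, ω y)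
    (hu : ∀ x ∈ D, ∀ y ∈ ball x ε, y ∉ D → u₁ y - u₂ y ≤ η)
    (hv : ∀ x ∈ D, ∀ y ∈ ball x ε, y ∉ D → v₁ y - v₂ y ≤ η) :
    ∀ x ∈ D, u₁ x - u₂ x ≤ η ∧ v₁ x - v₂ x ≤ η := by
  have hε2 : 0 < ε ^ 2 := by positivity
  have hε21 : ε ^ 2 < 1 := by nlinarith
  obtain ⟨C₁, hC₁⟩ := h₁.bounded
  obtain ⟨C₂, hC₂⟩ := h₂.bounded
  set d : EuclideanSpace ℝ (Fin N) → ℝ := fun x => max (u₁ x - u₂ x) (v₁ x - v₂ x) with hd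
  by_contra hcon
  push Not at hcon
  obtain ⟨x₀, hx₀, hcon⟩ := hcon
  have hx₀d : η < d x₀ := by
    by_cases h : u₁ x₀ - u₂ x₀ ≤ η
    · exact (hcon h).trans_le (le_max_right _ _)
    · exact (not_le.1 h).trans_le (le_max_left _ _)
  set K := sSup (d '' D)
  have hbdd : BddAbove (d '' D) := by
    refine ⟨C₁ + C₂, ?_⟩
    rintro _ ⟨x, hx, rfl⟩
    have a₁ := hC₁ x hx x (mem_ball_self hε)
    have a₂ := hC₂ x hx x (mem_ball_self hε)
    simp only [abs_le] at a₁ a₂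
    exact max_le (by linarith) (by linarith)
  have hdK : ∀ x ∈ D, d x ≤ K := fun x hx => le_csSup hbdd ⟨x, hx, rfl⟩
  have hηK : η < K := hx₀d.trans_le (hdK x₀ hx₀)
  have hball : ∀ x ∈ D, ∀ y ∈ ball x ε, u₁ y - u₂ y ≤ K ∧ v₁ y - v₂ y ≤ K := by
    intro x hx y hy
    by_cases hyD : y ∈ D
    · exact ⟨(le_max_left _ _).trans (hdK y hyD), (le_max_right _ _).trans (hdK y hyD)⟩
    · exact ⟨(hu x hx y hy hyD).trans hηK.le, (hv x hx y hy hyD).trans hηK.le⟩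
  -- The first equation transfers a strict gain in `v₁ - v₂` to `u₁ - u₂`.
  have hu_le : ∀ x ∈ D, u₁ x - u₂ x ≤ ε ^ 2 * (v₁ x - v₂ x) + (1 - ε ^ 2) * K := by
    intro x hx
    have := ballMid_le_add hε (u₁ := u₁) (u₂ := u₂) (C := max C₁ C₂) (m := K)
      (fun y hy => (hC₁ x hx y hy).1.trans (le_max_left _ _))
      (fun y hy => (hC₂ x hx y hy).1.trans (le_max_right _ _))
      (fun y hy => by linarith [(hball x hx y hy).1])
    rw [h₁.eq_first x hx, h₂.eq_first x hx]
    nlinarith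
  -- `p` compares `K - (v₁ - v₂)` with a multiple of `ω`; it satisfies a minimum principle.
  set p : EuclideanSpace ℝ (Fin N) → ℝ := fun x => K - (v₁ x - v₂ x) - (K - η) * ω x with hp
  have hp_step : ∀ q ≤ 0, (∀ y ∈ D, q ≤ p y) → ∀ x ∈ D, (1 - ε ^ 2) * q ≤ p x := by
    intro q hq hqp x hx
    have hqb : ∀ y ∈ ball x ε, v₁ y + (K - η) * ω y ≤ v₂ y + (K - q) := by
      intro y hy
      by_cases hyD : y ∈ D
      · have := hqp y hyD
        simp only [hp] at this
        linarith
      · have := hv x hx y hy hyD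
        have : (K - η) * ω y ≤ (K - η) * 1 := by gcongr; exact hω1 y
        linarith
    have hωi := (integrableOn_ball_of_continuous hωc x ε).const_mul (K - η)
    have hle := setAverage_ball_le_add hε ((h₁.integrableOn_ball x hx).add hωi)
      (h₂.integrableOn_ball x hx) hqb
    have hsplit : ⨍ y in ball x ε, (v₁ y + (K - η) * ω y)
        = (⨍ y in ball x ε, v₁ y) + (K - η) * ⨍ y in ball x ε, ω y := by
      simp only [setAverage_eq, smul_eq_mul]
      rw [integral_add (h₁.integrableOn_ball x hx) hωi, integral_const_mul]
      ring
    simp only [Pi.add_apply] at hle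
    rw [hsplit] at hle
    have e₁ := h₁.eq_second x hx
    have e₂ := h₂.eq_second x hx
    have hux := (hball x hx x (mem_ball_self hε)).1
    have i₁ := mul_le_mul_of_nonneg_left hle (sub_nonneg.2 hε21.le)
    have i₂ := mul_le_mul_of_nonneg_left hux hε2.le
    have i₃ := mul_le_mul_of_nonneg_left (hω x hx) (sub_nonneg.2 hηK.le)
    simp only [hp]
    linarith
  have hp_nonneg : ∀ x ∈ D, 0 ≤ p x := by
    have hpb : BddBelow (p '' D) := by
      refine ⟨-(K - η), ?_⟩
      rintro _ ⟨x, hx, rfl⟩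
      have := (hball x hx x (mem_ball_self hε)).2
      have : (K - η) * ω x ≤ (K - η) * 1 := by gcongr; exact hω1 x
      simp only [hp]
      linarith
    by_contra! hneg
    obtain ⟨x₁, hx₁, hx₁p⟩ := hneg
    have hle : ∀ y ∈ D, sInf (p '' D) ≤ p y := fun y hy => csInf_le hpb ⟨y, hy, rfl⟩
    have hq : sInf (p '' D) < 0 := (hle x₁ hx₁).trans_lt hx₁p
    have : (1 - ε ^ 2) * sInf (p '' D) ≤ sInf (p '' D) := by
      refine le_csInf ⟨p x₁, x₁, hx₁, rfl⟩ ?_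
      rintro _ ⟨x, hx, rfl⟩
      exact hp_step _ hq.le hle x hx
    nlinarith
  have hv_lt : ∀ x ∈ D, v₁ x - v₂ x ≤ K - (K - η) * c := by
    intro x hx
    have := hp_nonneg x hx
    have : (K - η) * c ≤ (K - η) * ω x := by gcongr; exact hωD x hx
    simp only [hp] at *
    linarith
  have hs : 0 < (K - η) * c := mul_pos (sub_pos.2 hηK) hc
  have : K ≤ K - ε ^ 2 * ((K - η) * c) := by
    refine csSup_le ⟨d x₀, x₀, hx₀, rfl⟩ ?_
    rintro _ ⟨x, hx, rfl⟩
    have h₃ := hv_lt x hx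
    refine max_le ?_ ?_
    · nlinarith [hu_le x hx]
    · nlinarith
  nlinarith

/-- `comparison` on subsets of a bounded set with the Gaussian as `ω`. The bound on `ε` is
independent of the subset and of the solutions. -/
theorem eventually_comparison (hN : 1 ≤ N) {Ω : Set (EuclideanSpace ℝ (Fin N))}
    (hΩ : Bornology.IsBounded Ω) :
    ∀ᶠ ε in 𝓝[>] (0 : ℝ), ∀ (D : Set (EuclideanSpace ℝ (Fin N)))
      (u₁ v₁ u₂ v₂ : EuclideanSpace ℝ (Fin N) → ℝ) (η : ℝ), D ⊆ Ω →
      IsDPPOn D ε u₁ v₁ → IsDPPOn D ε u₂ v₂ →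
      (∀ x ∈ D, ∀ y ∈ ball x ε, y ∉ D → u₁ y - u₂ y ≤ η ∧ v₁ y - v₂ y ≤ η) →
      ∀ x ∈ D, u₁ x - u₂ x ≤ η ∧ v₁ x - v₂ x ≤ η := by
  have : Nonempty (Fin N) := ⟨⟨0, hN⟩⟩
  obtain ⟨R, hR⟩ := hΩ.subset_closedBall 0
  obtain ⟨z, hz⟩ := exists_norm_eq (EuclideanSpace ℝ (Fin N)) (show 0 ≤ |R| + 1 by positivity)
  have hz1 : ∀ x ∈ Ω, 1 ≤ dist x z := by
    intro x hx
    have h1 : ‖x‖ ≤ R := by simpa using hR hx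
    have h2 := norm_le_norm_add_norm_sub x z
    rw [dist_eq_norm]
    have := le_abs_self R
    rw [hz] at h2
    rw [norm_sub_rev] at h2
    rw [norm_sub_rev]
    linarith
  have hz2 : ∀ x ∈ Ω, dist x z ≤ 2 * |R| + 1 := by
    intro x hx
    have h1 : ‖x‖ ≤ R := by simpa using hR hx
    have h2 := dist_le_norm_add_norm x z
    have := le_abs_self R
    linarith
  -- The smallest exponent allowed by `gaussian_le_setAverage` with `r = 1`; it is at least `2`,
  -- as needed to beat the factor `1 - ε ^ 2`.
  set α : ℝ := 2 / ((1 / 4) ^ N / 16) with hα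
  have hα2 : 2 ≤ α := by
    rw [hα, le_div_iff₀ (by positivity)]
    have : (1 / 4 : ℝ) ^ N ≤ 1 := pow_le_one₀ (by norm_num) (by norm_num)
    linarith
  have hα0 : 0 ≤ α := by linarith
  have hsmall : ∀ᶠ ε in 𝓝[>] (0 : ℝ), α * ε ^ 2 < 1 / 2 := by
    have : Tendsto (fun ε : ℝ => α * ε ^ 2) (𝓝 0) (𝓝 (α * 0 ^ 2)) :=
      Continuous.tendsto (by fun_prop) 0
    exact (this.mono_left nhdsWithin_le_nhds).eventually_lt_const (by norm_num)
  filter_upwards [hsmall, self_mem_nhdsWithin] with ε hαε hε D u₁ v₁ u₂ v₂ η hD h₁ h₂ hout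
  have hε : 0 < ε := hε
  have hε1 : ε < 1 := by nlinarith
  refine comparison h₁ h₂ hε hε1 (continuous_gaussian α z) (gaussian_le_one hα0 z)
    (Real.exp_pos (-α * (2 * |R| + 1) ^ 2)) ?_ ?_
    (fun x hx y hy hyD => (hout x hx y hy hyD).1) (fun x hx y hy hyD => (hout x hx y hy hyD).2)
  · intro x hx
    apply Real.exp_le_exp.2
    have : dist x z ^ 2 ≤ (2 * |R| + 1) ^ 2 := by
      gcongr
      exact hz2 x (hD hx)
    nlinarith
  · intro x hx
    have h := gaussian_le_setAverage hε hα0 hαε.le zero_le_one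
      (by rw [hα]; field_simp; norm_num) (hz1 x (hD hx))
    have hG := gaussian_pos α z x
    have hk : 1 ≤ (1 - ε ^ 2) * (1 + α * ε ^ 2) := by
      nlinarith [mul_nonneg (sub_nonneg.2 hα2) (sq_nonneg ε), mul_pos hε hε]
    calc gaussian α z x ≤ (1 - ε ^ 2) * (1 + α * ε ^ 2) * gaussian α z x :=
          le_mul_of_one_le_left hG.le hk
      _ = (1 - ε ^ 2) * ((1 + α * ε ^ 2) * gaussian α z x) := by ring
      _ ≤ _ := by
          gcongr
          nlinarith

end IsDPPOn

/-! ### The boundary estimate -/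

section Geometry

variable {N : ℕ}

/-- The ball with diameter from `y` to `z` is internally tangent at `y` to the ball about `z`
through `y`. Hence a point (almost) outside the large ball is outside the small one by a
quantitative margin, which grows with its distance from `y`. -/
theorem le_sq_dist_midpoint {x y z : EuclideanSpace ℝ (Fin N)} {θ ε : ℝ} (hyz : dist y z = θ)
    (hεθ : ε ≤ θ) (hxz : θ - ε ≤ dist x z) :
    (θ / 2) ^ 2 + dist x y ^ 2 / 2 - θ * ε ≤ dist x (midpoint ℝ y z) ^ 2 := by
  have e1 : x - midpoint ℝ y z = (x - y) - (1 / 2 : ℝ) • (z - y) := by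
    rw [midpoint_eq_smul_add, invOf_eq_inv]; module
  have e2 : x - z = (x - y) - (z - y) := by abel
  have hn : ‖z - y‖ = θ := by rw [← hyz, dist_comm, dist_eq_norm]
  have h1 : (θ - ε) ^ 2 ≤ dist x z ^ 2 := by
    have := sub_nonneg.2 hεθ
    gcongr
  rw [dist_eq_norm x z, e2, norm_sub_sq_real, hn, ← dist_eq_norm] at h1
  rw [dist_eq_norm x (midpoint ℝ y z), e1, norm_sub_sq_real, inner_smul_right, norm_smul, hn,
    ← dist_eq_norm, Real.norm_of_nonneg (by norm_num)]
  nlinarith [sq_nonneg ε]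

theorem le_dist_of_exteriorBall {Ω : Set (EuclideanSpace ℝ (Fin N))} (hΩ : IsOpen Ω)
    {y z : EuclideanSpace ℝ (Fin N)} {θ : ℝ} (hy : y ∈ frontier Ω)
    (h : closedBall z θ ∩ closure Ω = {y}) : dist y z = θ ∧ ∀ x ∈ Ω, θ ≤ dist x z := by
  have hyΩ : y ∉ Ω := by
    rw [hΩ.frontier_eq] at hy
    exact hy.2
  have hx : ∀ x ∈ Ω, θ < dist x z := by
    intro x hx
    by_contra! hle
    have : x ∈ ({y} : Set (EuclideanSpace ℝ (Fin N))) := h ▸ ⟨hle, subset_closure hx⟩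
    exact hyΩ (Set.mem_singleton_iff.1 this ▸ hx)
  have hle : dist y z ≤ θ := by
    have : y ∈ closedBall z θ ∩ closure Ω := h ▸ rfl
    exact this.1
  refine ⟨hle.antisymm ?_, fun x h => (hx x h).le⟩
  exact closure_minimal (t := {x | θ ≤ dist x z}) (fun x h => (hx x h).le)
    (isClosed_le continuous_const (by fun_prop))
    (frontier_subset_closure hy)

theorem exists_mem_frontier_dist_lt {Ω : Set (EuclideanSpace ℝ (Fin N))}
    {x x' : EuclideanSpace ℝ (Fin N)} {r : ℝ} (hx : x ∉ Ω) (hx' : x' ∈ Ω) (h : dist x x' < r) :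
    ∃ y ∈ frontier Ω, dist x y < r := by
  obtain ⟨y, hy, hd⟩ := exists_mem_frontier_infDist_compl_eq_dist (s := Ωᶜ) hx
    (fun h => (h ▸ Set.mem_univ x' : x' ∈ Ωᶜ) hx')
  rw [compl_compl] at hd
  exact ⟨y, frontier_compl Ω ▸ hy, hd ▸ (infDist_le_dist_of_mem hx').trans_lt h⟩

end Geometry

/-- A subsolution property, up to an error `L * ε ^ 2`, tested only against functions
`a - b * gaussian α z` with `b ≥ 0` at points at distance at least `r` from the centre `z`. Both
components of a solution of the dynamic programming principle, and their negatives, have it. -/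
def IsGaussianSub {N : ℕ} (Ω : Set (EuclideanSpace ℝ (Fin N))) (ε α r L : ℝ)
    (w : EuclideanSpace ℝ (Fin N) → ℝ) : Prop :=
  ∀ x ∈ Ω, ∀ (z : EuclideanSpace ℝ (Fin N)) (a b : ℝ), 0 ≤ b → r ≤ dist x z →
    (∀ y ∈ ball x ε, w y ≤ a - b * gaussian α z y) →
    w x ≤ a - b * ((1 + α * ε ^ 2) * gaussian α z x) + L * ε ^ 2

section Boundary

variable {N : ℕ} {Ω : Set (EuclideanSpace ℝ (Fin N))}

theorem IsDPPOn.isGaussianSub {ε α r C : ℝ} {u v : EuclideanSpace ℝ (Fin N) → ℝ}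
    (h : IsDPPOn Ω ε u v) (hε : 0 < ε) (hε1 : ε < 1) (hα : 0 ≤ α) (hαε : α * ε ^ 2 ≤ 1 / 2)
    (hr : 0 < r) (hαr : 2 ≤ α * ((1 / 4) ^ N / 16) * r ^ 2)
    (hC : ∀ x ∈ Ω, ∀ y ∈ ball x ε, |u y| ≤ C ∧ |v y| ≤ C) :
    IsGaussianSub Ω ε α r (2 * C) u ∧ IsGaussianSub Ω ε α r (2 * C) v := by
  constructor
  · intro x hx z a b hb hxz hle
    have hαr' : 2 ≤ α * r ^ 2 := by
      have h1 : (1 / 4 : ℝ) ^ N ≤ 1 := pow_le_one₀ (by norm_num) (by norm_num)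
      have h2 : (1 / 4 : ℝ) ^ N / 16 * (α * r ^ 2) ≤ 1 * (α * r ^ 2) := by gcongr; linarith
      linarith
    have hm := ballMid_le_of_le_sub_gaussian hε hα hαε hr hαr' hb hxz
      (fun y hy => (hC x hx y hy).1) hle
    have hlow := ballMid_le_add hε (u₁ := fun _ => -C) (u₂ := u) (x := x) (C := C) (m := 0)
      (fun y hy => by
        rw [abs_neg, abs_of_nonneg ((abs_nonneg _).trans (hC x hx y hy).1)])
      (fun y hy => (hC x hx y hy).1)
      (fun y hy => by linarith [(abs_le.1 (hC x hx y hy).1).1])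
    rw [ballMid_const hε] at hlow
    have hv := (abs_le.1 (hC x hx x (mem_ball_self hε)).2).2
    rw [h.eq_first x hx]
    nlinarith [sq_nonneg ε]
  · intro x hx z a b hb hxz hle
    have hG := integrableOn_ball_of_continuous (continuous_gaussian α z) x ε
    have hm := gaussian_le_setAverage hε hα hαε hr.le hαr hxz
    have hle' := setAverage_ball_le_add hε
      (v₁ := fun y => v y + b * gaussian α z y) (v₂ := fun _ => a) (m := 0)
      ((h.integrableOn_ball x hx).add (hG.const_mul b))
      (integrableOn_ball_of_continuous continuous_const x ε)
      (fun y hy => by linarith [hle y hy])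
    have hsplit : ⨍ y in ball x ε, (v y + b * gaussian α z y)
        = (⨍ y in ball x ε, v y) + b * ⨍ y in ball x ε, gaussian α z y := by
      simp only [setAverage_eq, smul_eq_mul]
      rw [integral_add (h.integrableOn_ball x hx) (hG.const_mul b), integral_const_mul]
      ring
    rw [hsplit, setAverage_ball_const hε] at hle'
    have hlow := setAverage_ball_le_add hε
      (v₁ := fun _ => -C) (v₂ := v) (m := 0)
      (integrableOn_ball_of_continuous continuous_const x ε) (h.integrableOn_ball x hx)
      (fun y hy => by linarith [(abs_le.1 (hC x hx y hy).2).1])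
    rw [setAverage_ball_const hε] at hlow
    have hu := (abs_le.1 (hC x hx x (mem_ball_self hε)).1).2
    have hb' := mul_le_mul_of_nonneg_left hm hb
    rw [h.eq_second x hx]
    nlinarith [sq_nonneg ε]

/-- Scalar comparison with a barrier `a - b * gaussian α z` that is steep enough to absorb the
error term of `IsGaussianSub`. -/
theorem IsGaussianSub.le_barrier {ε α r L C a b : ℝ} {w : EuclideanSpace ℝ (Fin N) → ℝ}
    {z : EuclideanSpace ℝ (Fin N)} (h : IsGaussianSub Ω ε α r L w) (hε : 0 < ε) (hα : 0 ≤ α)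
    (hb : 0 ≤ b) (hw : ∀ x ∈ Ω, ∀ y ∈ ball x ε, |w y| ≤ C) (hr : ∀ x ∈ Ω, r ≤ dist x z)
    (hsteep : ∀ x ∈ Ω, L + 1 ≤ b * α * gaussian α z x)
    (hout : ∀ x ∈ Ω, ∀ y ∈ ball x ε, y ∉ Ω → w y ≤ a - b * gaussian α z y) :
    ∀ x ∈ Ω, w x ≤ a - b * gaussian α z x := by
  set p : EuclideanSpace ℝ (Fin N) → ℝ := fun x => w x - (a - b * gaussian α z x) with hp
  by_contra! hcon
  obtain ⟨x₀, hx₀, hlt⟩ := hcon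
  set m := sSup (p '' Ω)
  have hbdd : BddAbove (p '' Ω) := by
    refine ⟨C - a + b, ?_⟩
    rintro _ ⟨x, hx, rfl⟩
    have h1 := (abs_le.1 (hw x hx x (mem_ball_self hε))).2
    have h2 := mul_le_mul_of_nonneg_left (gaussian_le_one hα z x) hb
    simp only [hp]
    linarith
  have hpm : ∀ x ∈ Ω, p x ≤ m := fun x hx => le_csSup hbdd ⟨x, hx, rfl⟩
  have hm : 0 < m := (sub_pos.2 hlt).trans_le (hpm x₀ hx₀)
  -- The steepness leaves a surplus `ε ^ 2` at each step, so `m` is not the least upper bound.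
  have : m ≤ m - ε ^ 2 := by
    refine csSup_le ⟨p x₀, x₀, hx₀, rfl⟩ ?_
    rintro _ ⟨x, hx, rfl⟩
    have h1 := h x hx z (a + m) b hb (hr x hx) (fun y hy => by
      by_cases hyΩ : y ∈ Ω
      · have := hpm y hyΩ
        simp only [hp] at this
        linarith
      · linarith [hout x hx y hy hyΩ])
    have h2 := mul_le_mul_of_nonneg_right (hsteep x hx) (sq_nonneg ε)
    simp only [hp]
    linarith
  nlinarith

theorem exists_le_mul_and_le_mul (a b : ℝ) {g e : ℝ} (hg : 0 < g) (he : 0 < e) :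
    ∃ A : ℝ, 0 ≤ A ∧ a ≤ A * g ∧ b ≤ A * e := by
  refine ⟨max 0 (max (a / g) (b / e)), le_max_left _ _, ?_, ?_⟩
  · rw [← div_le_iff₀ hg]
    exact (le_max_left _ _).trans (le_max_right _ _)
  · rw [← div_le_iff₀ he]
    exact (le_max_right _ _).trans (le_max_right _ _)

/-- One-sided boundary estimate, uniform in the boundary point and in the function. The barrier at
`y` is radial about the centre of a ball of half the radius of the exterior ball, so that it is
bounded away from `0` at a distance from `y`. -/
theorem eventually_le_add_of_isGaussianSub (hΩo : IsOpen Ω) (hΩb : Bornology.IsBounded Ω) {θ : ℝ}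
    (hθ : 0 < θ) (hball : ∀ y ∈ frontier Ω, ∃ z ∈ Ωᶜ, closedBall z θ ∩ closure Ω = {y})
    {F : EuclideanSpace ℝ (Fin N) → ℝ} {K : ℝ≥0} (hF : LipschitzOnWith K F Ωᶜ) {C L α η : ℝ}
    (hα : 0 < α) (hη : 0 < η) :
    ∃ δ > 0, ∀ᶠ ε in 𝓝[>] (0 : ℝ), ∀ w : EuclideanSpace ℝ (Fin N) → ℝ,
      (∀ x ∈ Ω, ∀ y ∈ ball x ε, |w y| ≤ C) → (∀ x ∈ Ωᶜ, w x = F x) →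
      IsGaussianSub Ω ε α (θ / 2) L w →
      ∀ y ∈ frontier Ω, ∀ x ∈ Ω, dist x y < δ → w x ≤ F y + η := by
  set R : ℝ := diam (closure Ω) + θ / 2
  have hR : 0 ≤ R := by positivity
  -- The value of the Gaussian at the boundary point.
  set E₀ : ℝ := Real.exp (-α * (θ / 2) ^ 2) with hE₀
  have hE₀p : 0 < E₀ := Real.exp_pos _
  have hE₀1 : E₀ ≤ 1 := Real.exp_le_one_iff.2 (by nlinarith [sq_nonneg (θ / 2)])
  set ρ : ℝ := η / (4 * (K + 1)) with hρ
  have hK : (0 : ℝ) ≤ K := K.2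
  have hρ0 : 0 < ρ := by positivity
  have hKρ : K * ρ ≤ η / 4 := by
    rw [hρ, mul_div_assoc', div_le_iff₀ (by positivity)]
    nlinarith
  -- The gain of the barrier at distance at least `ρ` from the boundary point.
  set g : ℝ := E₀ * (1 - Real.exp (-α * (ρ ^ 2 / 4))) with hg
  have hg0 : 0 < g := by
    refine mul_pos hE₀p (sub_pos.2 (Real.exp_lt_one_iff.2 ?_))
    have : 0 < α * (ρ ^ 2 / 4) := by positivity
    linarith
  have hR0 : 0 < α * Real.exp (-α * R ^ 2) := by positivity
  -- The height `A` makes the barrier exceed `F y + 2 * C` far from the boundary point and makes it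
  -- steep enough for `le_barrier`.
  obtain ⟨A, hA0, hAg, hAL⟩ := exists_le_mul_and_le_mul (2 * C) (L + 1) hg0 hR0
  rw [← mul_assoc] at hAL
  obtain ⟨δ, hδ, hδA⟩ : ∃ δ > 0, A * (E₀ - Real.exp (-α * (θ / 2 + δ) ^ 2)) < η / 2 := by
    have ht : Tendsto (fun δ : ℝ => A * (E₀ - Real.exp (-α * (θ / 2 + δ) ^ 2))) (𝓝[>] 0)
        (𝓝 (A * (E₀ - Real.exp (-α * (θ / 2 + 0) ^ 2)))) :=
      (Continuous.tendsto (by fun_prop) 0).mono_left nhdsWithin_le_nhds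
    rw [add_zero, ← hE₀, sub_self, mul_zero] at ht
    obtain ⟨δ, h1, h2⟩ := ((ht.eventually_lt_const (half_pos hη)).and self_mem_nhdsWithin).exists
    exact ⟨δ, h2, h1⟩
  have hε_exp : ∀ᶠ ε in 𝓝[>] (0 : ℝ), A * (Real.exp (α * (θ * ε)) - 1) < η / 4 := by
    have ht : Tendsto (fun ε : ℝ => A * (Real.exp (α * (θ * ε)) - 1)) (𝓝[>] 0)
        (𝓝 (A * (Real.exp (α * (θ * 0)) - 1))) :=
      (Continuous.tendsto (by fun_prop) 0).mono_left nhdsWithin_le_nhds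
    exact ht.eventually_lt_const (by simpa using hη)
  have hε_small : ∀ a > 0, ∀ᶠ ε in 𝓝[>] (0 : ℝ), ε < a := fun a ha =>
    (tendsto_id.mono_left nhdsWithin_le_nhds : Tendsto id (𝓝[>] (0 : ℝ)) (𝓝 0)).eventually_lt_const
      ha
  refine ⟨δ, hδ, ?_⟩
  filter_upwards [hε_exp, hε_small θ hθ, hε_small (ρ ^ 2 / (4 * θ)) (by positivity),
    self_mem_nhdsWithin] with ε hε1 hεθ hερ hε w hw hwF hsub y hy x hx hxy
  have hε : 0 < ε := hε
  obtain ⟨z, -, hz⟩ := hball y hy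
  obtain ⟨hyz, hΩz⟩ := le_dist_of_exteriorBall hΩo hy hz
  set p := midpoint ℝ y z
  have hyΩ : y ∈ Ωᶜ := by
    rw [hΩo.frontier_eq] at hy
    exact hy.2
  have hyp : dist y p = θ / 2 := by
    rw [dist_left_midpoint, hyz, Real.norm_of_nonneg (by norm_num)]
    ring
  have hΩp : ∀ x ∈ Ω, θ / 2 ≤ dist x p := by
    intro x hx
    have h1 := le_sq_dist_midpoint hyz hθ.le (by simpa using hΩz x hx)
    refine le_of_sq_le_sq ?_ dist_nonneg
    nlinarith [sq_nonneg (dist x y)]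
  have hΩR : ∀ x ∈ Ω, dist x p ≤ R := by
    intro x hx
    have h1 := dist_le_diam_of_mem hΩb.closure (subset_closure hx) (frontier_subset_closure hy)
    have h2 := dist_triangle x y p
    exact h2.trans (add_le_add h1 hyp.le)
  have hFy : -C ≤ F y := by
    obtain ⟨x', hx', hd⟩ := Metric.mem_closure_iff.1 (frontier_subset_closure hy) ε hε
    rw [← hwF y hyΩ]
    exact (abs_le.1 (hw x' hx' y hd)).1
  have hbar := hsub.le_barrier (z := p) (a := F y + η / 2 + A * E₀) hε hα.le hA0 hw hΩp ?_ ?_ x hx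
  · have h1 : dist x p ≤ θ / 2 + δ := by
      rw [add_comm, ← hyp]
      exact (dist_triangle x y p).trans (add_le_add_left hxy.le _)
    have h2 : Real.exp (-α * (θ / 2 + δ) ^ 2) ≤ gaussian α p x := by
      apply Real.exp_le_exp.2
      have : dist x p ^ 2 ≤ (θ / 2 + δ) ^ 2 := by gcongr
      nlinarith
    have h3 := mul_le_mul_of_nonneg_left h2 hA0
    linarith
  · intro x hx
    refine hAL.trans ?_
    have : Real.exp (-α * R ^ 2) ≤ gaussian α p x := by
      apply Real.exp_le_exp.2
      have : dist x p ^ 2 ≤ R ^ 2 := by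
        gcongr
        exact hΩR x hx
      nlinarith
    gcongr
  · intro x₁ hx₁ x' hx' hx'Ω
    have hzx' : θ - ε ≤ dist x' z := by
      have h1 := hΩz x₁ hx₁
      have h2 := dist_triangle x₁ x' z
      have h3 := mem_ball'.1 hx'
      linarith
    have hq := le_sq_dist_midpoint hyz hεθ.le hzx'
    have hLip : F x' ≤ F y + K * dist x' y := by
      have h1 := hF.dist_le_mul x' hx'Ω y hyΩ
      rw [Real.dist_eq] at h1
      linarith [(abs_le.1 h1).2]
    have hwx : |w x'| ≤ C := hw x₁ hx₁ x' hx'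
    have hexp : ∀ q, (θ / 2) ^ 2 + q ≤ dist x' p ^ 2 →
        gaussian α p x' ≤ E₀ * Real.exp (-α * q) := by
      intro q hq
      rw [hE₀, ← Real.exp_add]
      apply Real.exp_le_exp.2
      have := mul_le_mul_of_nonneg_left hq hα.le
      linarith
    rcases le_total (dist x' y) ρ with hnear | hfar
    -- Close to `y` the barrier may dip slightly below `F y + η / 2` since `x'` is off `Ω`.
    · have h1 := hexp (-(θ * ε)) (by linarith [sq_nonneg (dist x' y)])
      rw [show -α * -(θ * ε) = α * (θ * ε) by ring] at h1
      have h2 : 0 ≤ Real.exp (α * (θ * ε)) - 1 := by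
        have := Real.add_one_le_exp (α * (θ * ε))
        have : 0 ≤ α * (θ * ε) := by positivity
        linarith
      have h3 : gaussian α p x' - E₀ ≤ Real.exp (α * (θ * ε)) - 1 := by
        have := mul_le_mul_of_nonneg_right hE₀1 h2
        linarith
      have h4 := mul_le_mul_of_nonneg_left h3 hA0
      have h5 : K * dist x' y ≤ K * ρ := by gcongr
      rw [hwF x' hx'Ω]
      linarith
    · have h1 : θ * ε ≤ ρ ^ 2 / 4 := by
        rw [lt_div_iff₀ (by positivity)] at hερ
        linarith
      have h2 := hexp (ρ ^ 2 / 4) (by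
        have : ρ ^ 2 ≤ dist x' y ^ 2 := by gcongr
        linarith)
      have h3 : g ≤ E₀ - gaussian α p x' := by rw [hg]; linarith
      have h4 := mul_le_mul_of_nonneg_left h3 hA0
      linarith [(abs_le.1 hwx).2]

end Boundary

/-! ### Compactness of asymptotically equicontinuous sequences -/

/-- A version of the Arzelà–Ascoli theorem for sequences of possibly discontinuous functions whose
oscillation at small scales is small only for large indices. -/
theorem exists_subseq_tendstoUniformlyOn {X : Type*} [PseudoMetricSpace X] {s : Set X}
    (hs : IsCompact s) (F : ℕ → X → ℝ) {C : ℝ} (hC : ∀ᶠ j in atTop, ∀ x ∈ s, |F j x| ≤ C)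
    (hF : ∀ η > 0, ∃ δ > 0, ∀ᶠ j in atTop, ∀ x ∈ s, ∀ x' ∈ s, dist x x' < δ →
      |F j x - F j x'| ≤ η) :
    ∃ (φ : ℕ → ℕ) (u : X → ℝ), StrictMono φ ∧ ContinuousOn u s ∧
      TendstoUniformlyOn (fun k => F (φ k)) u atTop s := by
  obtain ⟨t, hts, htc, hst⟩ := hs.isSeparable.exists_countable_dense_subset
  have : Countable t := htc.to_subtype
  have hK : IsCompact (Set.univ.pi fun _ : t => Set.Icc (-C) C) :=
    isCompact_univ_pi fun _ => isCompact_Icc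
  obtain ⟨a, -, φ, hφ, hlim⟩ := hK.tendsto_subseq' (x := fun j (y : t) => F j y.1)
    (hC.mono fun j hj (y : t) _ => abs_le.1 (hj y.1 (hts y.2))).frequently
  have hφt := hφ.tendsto_atTop
  rw [tendsto_pi_nhds] at hlim
  have hcauchy : UniformCauchySeqOn (fun k => F (φ k)) atTop s := by
    rw [Metric.uniformCauchySeqOn_iff]
    intro η hη
    obtain ⟨δ, hδ, hev⟩ := hF (η / 4) (by positivity)
    obtain ⟨t', ht't, ht'f, hcov⟩ := hs.elim_finite_subcover_image (b := t) (c := fun y => ball y δ)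
      (fun _ _ => isOpen_ball) (fun x hx => by
        obtain ⟨y, hy, hxy⟩ := Metric.mem_closure_iff.1 (hst hx) δ hδ
        exact Set.mem_biUnion hy hxy)
    have hfin : ∀ᶠ k in atTop, ∀ y ∈ t', ∀ hy : y ∈ t, |F (φ k) y - a ⟨y, hy⟩| < η / 8 := by
      rw [ht'f.eventually_all]
      intro y hy
      filter_upwards [Metric.tendsto_nhds.1 (hlim ⟨y, ht't hy⟩) (η / 8) (by positivity)] with k hk _
      simpa [Real.dist_eq] using hk
    obtain ⟨n, hn⟩ := eventually_atTop.1 (hfin.and (hφt.eventually hev))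
    refine ⟨n, fun m hm k hk x hx => ?_⟩
    obtain ⟨y, hy, hxy⟩ := Set.mem_iUnion₂.1 (hcov hx)
    have hyt := ht't hy
    have hm1 := (hn m hm).1 y hy hyt
    have hk1 := (hn k hk).1 y hy hyt
    have hm2 := (hn m hm).2 x hx y (hts hyt) hxy
    have hk2 := (hn k hk).2 x hx y (hts hyt) hxy
    rw [Real.dist_eq]
    rw [abs_lt] at *
    rw [abs_le] at *
    constructor <;> linarith [hm1.1, hm1.2, hk1.1, hk1.2, hm2.1, hm2.2, hk2.1, hk2.2]
  have hpt : ∀ x, ∃ l, x ∈ s → Tendsto (fun k => F (φ k) x) atTop (𝓝 l) := by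
    intro x
    by_cases hx : x ∈ s
    · obtain ⟨l, hl⟩ := cauchySeq_tendsto_of_complete (hcauchy.cauchySeq hx)
      exact ⟨l, fun _ => hl⟩
    · exact ⟨0, fun h => (hx h).elim⟩
  choose u hu using hpt
  refine ⟨φ, u, hφ, ?_, hcauchy.tendstoUniformlyOn_of_tendsto fun x hx => hu x hx⟩
  rw [Metric.continuousOn_iff]
  intro x hx η hη
  obtain ⟨δ, hδ, hev⟩ := hF (η / 2) (by positivity)
  refine ⟨δ, hδ, fun x' hx' hd => ?_⟩
  have : |u x' - u x| ≤ η / 2 :=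
    le_of_tendsto ((hu x' hx').sub (hu x hx)).abs
      ((hφt.eventually hev).mono fun k hk => hk x' hx' x hx hd)
  rw [Real.dist_eq]
  linarith

/-! ### Uniform bounds and asymptotic equicontinuity -/

section Estimates

variable {N : ℕ} {Ω : Set (EuclideanSpace ℝ (Fin N))} {f g : EuclideanSpace ℝ (Fin N) → ℝ}

theorem exists_abs_le_near_of_lipschitzOnWith {s t : Set (EuclideanSpace ℝ (Fin N))} {K : ℝ≥0}
    (hf : LipschitzOnWith K f s) (ht : Bornology.IsBounded t) :
    ∃ B : ℝ, ∀ x ∈ s ∩ t, |f x| ≤ B := by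
  rcases (s ∩ t).eq_empty_or_nonempty with h | ⟨x₀, hx₀⟩
  · exact ⟨0, by simp [h]⟩
  refine ⟨|f x₀| + K * diam t, fun x hx => ?_⟩
  have h1 := hf.dist_le_mul x hx.1 x₀ hx₀.1
  have h2 : (K : ℝ) * dist x x₀ ≤ K * diam t := by
    gcongr
    exact dist_le_diam_of_mem ht hx.2 hx₀.2
  rw [Real.dist_eq] at h1
  have h3 := abs_add_le (f x - f x₀) (f x₀)
  rw [sub_add_cancel] at h3
  linarith

/-- Solutions of the dynamic programming principle are bounded, for small `ε`, by a bound `B` of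
the exterior data near `Ω`: this is the comparison with the constant solutions `±B`. -/
theorem eventually_abs_le (hN : 1 ≤ N) (hΩ : Bornology.IsBounded Ω)
    (hf : ∃ K : ℝ≥0, LipschitzOnWith K f Ωᶜ) (hg : ∃ K : ℝ≥0, LipschitzOnWith K g Ωᶜ) :
    ∃ B : ℝ, ∀ᶠ ε in 𝓝[>] (0 : ℝ), ∀ u v : EuclideanSpace ℝ (Fin N) → ℝ,
      IsDPPSolution Ω f g ε u v →
      IsDPPOn Ω ε u v ∧ ∀ x ∈ Ω, ∀ y ∈ ball x ε, |u y| ≤ B ∧ |v y| ≤ B := by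
  obtain ⟨Kf, hf⟩ := hf
  obtain ⟨Kg, hg⟩ := hg
  obtain ⟨Bf, hBf⟩ := exists_abs_le_near_of_lipschitzOnWith hf (hΩ.thickening (δ := 1))
  obtain ⟨Bg, hBg⟩ := exists_abs_le_near_of_lipschitzOnWith hg (hΩ.thickening (δ := 1))
  refine ⟨max Bf Bg, ?_⟩
  have h1 : ∀ᶠ ε in 𝓝[>] (0 : ℝ), ε < 1 :=
    (tendsto_id.mono_left nhdsWithin_le_nhds : Tendsto id (𝓝[>] (0 : ℝ)) (𝓝 0)).eventually_lt_const
      one_pos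
  filter_upwards [IsDPPOn.eventually_comparison hN hΩ, h1, self_mem_nhdsWithin]
    with ε hcomp hε1 hε u v h
  have hε : 0 < ε := hε
  set B := max Bf Bg
  have hout : ∀ x ∈ Ω, ∀ y ∈ ball x ε, y ∉ Ω → |u y| ≤ B ∧ |v y| ≤ B := by
    intro x hx y hy hyΩ
    have hyt : y ∈ thickening 1 Ω := mem_thickening_iff.2 ⟨x, hx, (mem_ball.1 hy).trans hε1⟩
    rw [h.exterior_first y hyΩ, h.exterior_second y hyΩ]
    exact ⟨(hBf y ⟨hyΩ, hyt⟩).trans (le_max_left _ _), (hBg y ⟨hyΩ, hyt⟩).trans (le_max_right _ _)⟩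
  have hD : IsDPPOn Ω ε u v :=
    { bounded := by
        obtain ⟨C, hC⟩ := h.bounded
        refine ⟨max C B, fun x hx y hy => ?_⟩
        by_cases hyΩ : y ∈ Ω
        · exact (hC y hyΩ).imp (·.trans (le_max_left _ _)) (·.trans (le_max_left _ _))
        · exact (hout x hx y hy hyΩ).imp (·.trans (le_max_right _ _)) (·.trans (le_max_right _ _))
      integrableOn_ball := h.integrableOn_ball
      eq_first := h.eq_first
      eq_second := h.eq_second }
  refine ⟨hD, fun x hx y hy => ?_⟩
  by_cases hyΩ : y ∈ Ω
  · have hup := hcomp Ω u v _ _ 0 le_rfl hD (IsDPPOn.const hε Ω B) (fun x hx y hy hyΩ => by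
      have := hout x hx y hy hyΩ
      simp only [abs_le] at this
      constructor <;> linarith) y hyΩ
    have hlow := hcomp Ω _ _ u v 0 le_rfl (IsDPPOn.const hε Ω (-B)) hD (fun x hx y hy hyΩ => by
      have := hout x hx y hy hyΩ
      simp only [abs_le] at this
      constructor <;> linarith) y hyΩ
    simp only [abs_le]
    exact ⟨⟨by linarith [hlow.1], by linarith [hup.1]⟩, ⟨by linarith [hlow.2], by linarith [hup.2]⟩⟩
  · exact hout x hx y hy hyΩ

/-- Near the boundary a solution is close to the exterior datum at the boundary point, uniformly
in the point, in the solution and in small `ε`. -/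
theorem eventually_abs_sub_le_near_boundary (hN : 1 ≤ N) (hΩo : IsOpen Ω)
    (hΩb : Bornology.IsBounded Ω) (hball : UniformExteriorBall Ω)
    (hf : ∃ K : ℝ≥0, LipschitzOnWith K f Ωᶜ) (hg : ∃ K : ℝ≥0, LipschitzOnWith K g Ωᶜ) {η : ℝ}
    (hη : 0 < η) :
    ∃ δ > 0, ∀ᶠ ε in 𝓝[>] (0 : ℝ), ∀ u v : EuclideanSpace ℝ (Fin N) → ℝ,
      IsDPPSolution Ω f g ε u v → ∀ y ∈ frontier Ω, ∀ x, dist x y < δ →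
      |u x - f y| ≤ η ∧ |v x - g y| ≤ η := by
  obtain ⟨B, hB⟩ := eventually_abs_le hN hΩb hf hg
  obtain ⟨Kf, hf⟩ := hf
  obtain ⟨Kg, hg⟩ := hg
  obtain ⟨θ, hθ, hball⟩ := hball
  set c : ℝ := (1 / 4) ^ N / 16 with hc
  have hc0 : 0 < c := by positivity
  set α : ℝ := 2 / (c * (θ / 2) ^ 2) with hα
  have hα0 : 0 < α := by positivity
  have hαr : 2 ≤ α * c * (θ / 2) ^ 2 := by
    rw [hα]
    apply le_of_eq
    field_simp
  obtain ⟨δ₁, hδ₁, h₁⟩ := eventually_le_add_of_isGaussianSub (C := B) (L := 2 * B) hΩo hΩb hθ hball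
    hf hα0 hη
  obtain ⟨δ₂, hδ₂, h₂⟩ := eventually_le_add_of_isGaussianSub (C := B) (L := 2 * B) hΩo hΩb hθ hball
    hg hα0 hη
  obtain ⟨δ₃, hδ₃, h₃⟩ := eventually_le_add_of_isGaussianSub (C := B) (L := 2 * B) hΩo hΩb hθ hball
    hf.neg hα0 hη
  obtain ⟨δ₄, hδ₄, h₄⟩ := eventually_le_add_of_isGaussianSub (C := B) (L := 2 * B) hΩo hΩb hθ hball
    hg.neg hα0 hη
  have hout : ∀ {F : EuclideanSpace ℝ (Fin N) → ℝ} {K : ℝ≥0}, LipschitzOnWith K F Ωᶜ →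
      ∀ y ∈ frontier Ω, ∀ x ∈ Ωᶜ, dist x y < η / (K + 1) → |F x - F y| ≤ η := by
    intro F K hF y hy x hx hxy
    have hyΩ : y ∈ Ωᶜ := by
      rw [hΩo.frontier_eq] at hy
      exact hy.2
    have h1 := hF.dist_le_mul x hx y hyΩ
    rw [Real.dist_eq] at h1
    rw [lt_div_iff₀ (by positivity)] at hxy
    linarith [dist_nonneg (x := x) (y := y)]
  have hsmall : ∀ᶠ ε in 𝓝[>] (0 : ℝ), α * ε ^ 2 < 1 / 2 := by
    have : Tendsto (fun ε : ℝ => α * ε ^ 2) (𝓝 0) (𝓝 (α * 0 ^ 2)) :=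
      Continuous.tendsto (by fun_prop) 0
    exact (this.mono_left nhdsWithin_le_nhds).eventually_lt_const (by norm_num)
  have h1 : ∀ᶠ ε in 𝓝[>] (0 : ℝ), ε < 1 :=
    (tendsto_id.mono_left nhdsWithin_le_nhds : Tendsto id (𝓝[>] (0 : ℝ)) (𝓝 0)).eventually_lt_const
      one_pos
  refine ⟨min (min (min δ₁ δ₂) (min δ₃ δ₄)) (min (η / (Kf + 1)) (η / (Kg + 1))), by positivity, ?_⟩
  filter_upwards [h₁, h₂, h₃, h₄, hB, hsmall, h1, self_mem_nhdsWithin]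
    with ε h₁ h₂ h₃ h₄ hB hαε hε1 hε u v h y hy x hxy
  have hε : 0 < ε := hε
  simp only [lt_min_iff] at hxy
  obtain ⟨⟨⟨hx₁, hx₂⟩, hx₃, hx₄⟩, hxf, hxg⟩ := hxy
  by_cases hx : x ∈ Ω
  · obtain ⟨hD, hb⟩ := hB u v h
    have hb' : ∀ x ∈ Ω, ∀ y ∈ ball x ε, |-u y| ≤ B ∧ |-v y| ≤ B := by simpa only [abs_neg] using hb
    obtain ⟨su, sv⟩ := hD.isGaussianSub hε hε1 hα0.le hαε.le (half_pos hθ) hαr hb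
    obtain ⟨su', sv'⟩ := hD.neg.isGaussianSub hε hε1 hα0.le hαε.le (half_pos hθ) hαr hb'
    have a₁ := h₁ u (fun x hx y hy => (hb x hx y hy).1) h.exterior_first su y hy x hx hx₁
    have a₂ := h₂ v (fun x hx y hy => (hb x hx y hy).2) h.exterior_second sv y hy x hx hx₂
    have a₃ := h₃ _ (fun x hx y hy => (hb' x hx y hy).1)
      (fun x hx => by rw [h.exterior_first x hx]; rfl) su' y hy x hx hx₃
    have a₄ := h₄ _ (fun x hx y hy => (hb' x hx y hy).2)
      (fun x hx => by rw [h.exterior_second x hx]; rfl) sv' y hy x hx hx₄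
    simp only [Pi.neg_apply] at a₃ a₄
    simp only [abs_le]
    exact ⟨⟨by linarith, by linarith⟩, ⟨by linarith, by linarith⟩⟩
  · rw [h.exterior_first x hx, h.exterior_second x hx]
    exact ⟨hout hf y hy x hx hxf, hout hg y hy x hx hxg⟩

/-- Asymptotic equicontinuity. On `D = Ω ∩ (Ω - a)` the solution and its translate by `a` both
solve the equations, and off `D` they are close by the boundary estimate; comparison does the
rest. -/
theorem eventually_abs_sub_le (hN : 1 ≤ N) (hΩo : IsOpen Ω)
    (hΩb : Bornology.IsBounded Ω) (hball : UniformExteriorBall Ω)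
    (hf : ∃ K : ℝ≥0, LipschitzOnWith K f Ωᶜ) (hg : ∃ K : ℝ≥0, LipschitzOnWith K g Ωᶜ) {η : ℝ}
    (hη : 0 < η) :
    ∃ δ > 0, ∀ᶠ ε in 𝓝[>] (0 : ℝ), ∀ u v : EuclideanSpace ℝ (Fin N) → ℝ,
      IsDPPSolution Ω f g ε u v → ∀ x ∈ closure Ω, ∀ x' ∈ closure Ω, dist x x' < δ →
      |u x - u x'| ≤ η ∧ |v x - v x'| ≤ η := by
  obtain ⟨B, hB⟩ := eventually_abs_le hN hΩb hf hg
  obtain ⟨δ, hδ, hbd⟩ := eventually_abs_sub_le_near_boundary hN hΩo hΩb hball hf hg (half_pos hη)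
  have hεδ : ∀ᶠ ε in 𝓝[>] (0 : ℝ), ε < δ / 2 :=
    (tendsto_id.mono_left nhdsWithin_le_nhds : Tendsto id (𝓝[>] (0 : ℝ)) (𝓝 0)).eventually_lt_const
      (half_pos hδ)
  refine ⟨δ / 2, half_pos hδ, ?_⟩
  filter_upwards [hbd, hB, hεδ, IsDPPOn.eventually_comparison hN hΩb, self_mem_nhdsWithin]
    with ε hbd hB hεδ hcomp hε u v h x hx x' hx' hxx'
  have hε : 0 < ε := hε
  obtain ⟨hD, -⟩ := hB u v h
  have hnear : ∀ y ∈ frontier Ω, ∀ x₁ x₂, dist x₁ y < δ → dist x₂ y < δ →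
      |u x₁ - u x₂| ≤ η ∧ |v x₁ - v x₂| ≤ η := by
    intro y hy x₁ x₂ h₁ h₂
    have b₁ := hbd u v h y hy x₁ h₁
    have b₂ := hbd u v h y hy x₂ h₂
    simp only [abs_le] at b₁ b₂ ⊢
    obtain ⟨⟨_, _⟩, _, _⟩ := b₁
    obtain ⟨⟨_, _⟩, _, _⟩ := b₂
    exact ⟨⟨by linarith, by linarith⟩, ⟨by linarith, by linarith⟩⟩
  by_cases hxΩ : x ∈ Ω
  swap
  · have hy : x ∈ frontier Ω := hΩo.frontier_eq ▸ ⟨hx, hxΩ⟩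
    exact hnear x hy x x' (by simpa using hδ) (by rw [dist_comm]; linarith)
  by_cases hx'Ω : x' ∈ Ω
  swap
  · have hy : x' ∈ frontier Ω := hΩo.frontier_eq ▸ ⟨hx', hx'Ω⟩
    exact hnear x' hy x x' (by linarith) (by simpa using hδ)
  set a := x' - x with ha
  have hda : ∀ p, dist p (p + a) < δ / 2 := by
    intro p
    rwa [dist_self_add_right, ha, ← dist_eq_norm, dist_comm]
  set D := Ω ∩ {p | p + a ∈ Ω} with hDdef
  have hsh := (hD.comp_add_right a).mono (D' := D) Set.inter_subset_right
  have hD' := hD.mono (D' := D) Set.inter_subset_left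
  have hstrip : ∀ p ∈ D, ∀ q ∈ ball p ε, q ∉ D →
      |u q - u (q + a)| ≤ η ∧ |v q - v (q + a)| ≤ η := by
    intro p hp q hq hqD
    have hq := mem_ball.1 hq
    by_cases hqΩ : q ∈ Ω
    · have hqa : q + a ∉ Ω := fun hqa => hqD ⟨hqΩ, hqa⟩
      obtain ⟨y, hy, hyd⟩ := exists_mem_frontier_dist_lt hqa hp.2 (by simpa using hq)
      have := dist_triangle q (q + a) y
      have := hda q
      exact hnear y hy _ _ (by linarith) (by linarith)
    · obtain ⟨y, hy, hyd⟩ := exists_mem_frontier_dist_lt hqΩ hp.1 hq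
      have := dist_triangle_left (q + a) y q
      have := hda q
      exact hnear y hy _ _ (by linarith) (by linarith)
  have hxD : x ∈ D := ⟨hxΩ, by simpa [ha] using hx'Ω⟩
  have h₁ := hcomp D _ _ _ _ η Set.inter_subset_left hD' hsh (fun p hp q hq hqD => by
    have := hstrip p hp q hq hqD
    simp only [abs_le] at this
    exact ⟨this.1.2, this.2.2⟩) x hxD
  have h₂ := hcomp D _ _ _ _ η Set.inter_subset_left hsh hD' (fun p hp q hq hqD => by
    have := hstrip p hp q hq hqD
    simp only [abs_le] at this
    exact ⟨by linarith [this.1.1], by linarith [this.2.1]⟩) x hxD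
  have hxa : x + a = x' := by simp [ha]
  simp only [hxa] at h₁ h₂
  simp only [abs_le]
  exact ⟨⟨by linarith [h₂.1], h₁.1⟩, ⟨by linarith [h₂.2], h₁.2⟩⟩

end Estimates

theorem theorem4p5 {N : ℕ} (hN : 1 ≤ N)
    (Ω : Set (EuclideanSpace ℝ (Fin N))) (hΩ_open : IsOpen Ω) (hΩ_conn : IsConnected Ω)
    (hΩ_bdd : Bornology.IsBounded Ω) (hΩ_ball : UniformExteriorBall Ω)
    (f g : EuclideanSpace ℝ (Fin N) → ℝ)
    (hf : ∃ K : ℝ≥0, LipschitzOnWith K f Ωᶜ) (hg : ∃ K : ℝ≥0, LipschitzOnWith K g Ωᶜ)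
    (ε : ℕ → ℝ) (hε_pos : ∀ j, 0 < ε j) (hε_lim : Tendsto ε atTop (𝓝 0))
    (uε vε : ℕ → EuclideanSpace ℝ (Fin N) → ℝ)
    (hsol : ∀ j, IsDPPSolution Ω f g (ε j) (uε j) (vε j)) :
    ∃ (φ : ℕ → ℕ) (u v : EuclideanSpace ℝ (Fin N) → ℝ),
      StrictMono φ ∧
      ContinuousOn u (closure Ω) ∧ ContinuousOn v (closure Ω) ∧
      TendstoUniformlyOn (fun k => uε (φ k)) u atTop (closure Ω) ∧
      TendstoUniformlyOn (fun k => vε (φ k)) v atTop (closure Ω) := by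
  have hε : Tendsto ε atTop (𝓝[>] 0) :=
    tendsto_nhdsWithin_iff.2 ⟨hε_lim, Eventually.of_forall hε_pos⟩
  have hcpt : IsCompact (closure Ω) := hΩ_bdd.isCompact_closure
  obtain ⟨B, hB⟩ := eventually_abs_le hN hΩ_bdd hf hg
  have hbound : ∀ᶠ j in atTop, ∀ x ∈ closure Ω, |uε j x| ≤ B ∧ |vε j x| ≤ B := by
    filter_upwards [hε.eventually hB] with j hj x hx
    obtain ⟨x', hx', hd⟩ := Metric.mem_closure_iff.1 hx (ε j) (hε_pos j)
    exact (hj _ _ (hsol j)).2 x' hx' x hd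
  have hequi : ∀ η > 0, ∃ δ > 0, ∀ᶠ j in atTop, ∀ x ∈ closure Ω, ∀ x' ∈ closure Ω,
      dist x x' < δ → |uε j x - uε j x'| ≤ η ∧ |vε j x - vε j x'| ≤ η := by
    intro η hη
    obtain ⟨δ, hδ, h⟩ := eventually_abs_sub_le hN hΩ_open hΩ_bdd hΩ_ball hf hg hη
    exact ⟨δ, hδ, (hε.eventually h).mono fun j hj => hj _ _ (hsol j)⟩
  obtain ⟨φ, u, hφ, hu, hφu⟩ := exists_subseq_tendstoUniformlyOn hcpt uε
    (hbound.mono fun j hj x hx => (hj x hx).1) fun η hη => by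
      obtain ⟨δ, hδ, h⟩ := hequi η hη
      exact ⟨δ, hδ, h.mono fun j hj x hx x' hx' hd => (hj x hx x' hx' hd).1⟩
  obtain ⟨ψ, v, hψ, hv, hψv⟩ := exists_subseq_tendstoUniformlyOn hcpt (fun k => vε (φ k))
    ((hφ.tendsto_atTop.eventually hbound).mono fun j hj x hx => (hj x hx).2) fun η hη => by
      obtain ⟨δ, hδ, h⟩ := hequi η hη
      exact ⟨δ, hδ, (hφ.tendsto_atTop.eventually h).mono
        fun j hj x hx x' hx' hd => (hj x hx x' hx' hd).2⟩
  exact ⟨φ ∘ ψ, u, v, hφ.comp hψ, hu, hv,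
    fun s hs => hψ.tendsto_atTop.eventually (hφu s hs), hψv⟩
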